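/- All systems are finite-dimensional, nonzero complex Hilbert spaces; $|A|$ is the dimension of $A$, $AB$ stands for $A\otimes B$, and $\mathrm{CPTP}(A\to B)$ is the set of quantum channels from $A$ to $B$. An isometry channel is a channel of the form $\rho\mapsto V\rho V^\dagger$ with $V^\dagger V=\mathbf 1$, and $\mathbf u^{B}=\mathbf 1_B/|B|$ is the uniform state. States are regarded as channels with one-dimensional input. Every superchannel $\Theta$ taking channels $A\to B$ to channels $A'\to B$ has the form $\Theta[\mathcal N]=\mathcal E^{RB\to B}\circ(\mathsf{id}^R\otimes\mathcal N^{A\to B})\circ\mathcal U^{A'\to RA}$ with an isometry channel $\mathcal U$ and a channel $\mathcal E$; it is in standard form if $|R|$ is the least possible. $\Theta$ is mixing if in its standard form $\mathcal E$ is conditionally unital, i.e. $\omega\mapsto\mathcal E(\tau^R\otimes\omega)$ is a unital channel for every density matrix $\tau$ on $R$. For $\mathcal N\in\mathrm{CPTP}(A\to B)$ and $\mathcal M\in\mathrm{CPTP}(A'\to B)$ write $\mathcal N\succ\mathcal M$ if $\mathcal M=\Theta[\mathcal N]$ for some mixing superchannel $\Theta$, and $\mathcal N\sim\mathcal M$ if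 $\mathcal N\succ\mathcal M$ and $\mathcal M\succ\mathcal N$. **Theorem.** Let $\mathcal V\in\mathrm{CPTP}(A\to B)$ be an isometry channel. 1. If $|B'|=|A|$, then $\mathcal V^{A\to B}\otimes\mathbf u^{B'}\sim\psi^{BB'}$ for every pure state $\psi$ of $BB'$. 2. More generally, let $B',C,D,D'$ be systems with $|BB'|=|DD'|$ and $|AB|\ge|CD|$, and let $\mathcal M\in\mathrm{CPTP}(C\to D)$ be any channel. Then $\mathcal V^{A\to B}\otimes\mathbf u^{B'}\succ\mathcal M^{C\to D}\otimes\mathbf u^{D'}$, where $BB'$ and $DD'$ are identified by an arbitrary unitary. 3. In particular, isometry channels are maximal: $\mathcal V\succ\mathcal M$ for every $\mathcal M\in\mathrm{CPTP}(A\to B)$. -/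

import Mathlib

open scoped Kronecker ComplexOrder

namespace ChannelMajorization

/-- A finite-dimensional system with orthonormal basis labelled by `A` has the operator space
`Matrix A A ℂ`. Linear maps from the operators on `A` to the operators on `B`. -/
abbrev MatMap (A B : Type*) := Matrix A A ℂ →ₗ[ℂ] Matrix B B ℂ

/-- The map `id_R ⊗ Φ`: apply `Φ` to every `A`-block of an operator on `R ⊗ A`. -/
def ampliate (R : Type*) {A B : Type*} (Φ : MatMap A B) : MatMap (R × A) (R × B) where
  toFun X := Matrix.of fun p q =>
    Φ (Matrix.of fun a a' => X (p.1, a) (q.1, a')) p.2 q.2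
  map_add' X Y := by
    ext p q
    have h : (Matrix.of fun a a' => (X + Y) (p.1, a) (q.1, a')) =
        (Matrix.of fun a a' => X (p.1, a) (q.1, a')) +
          (Matrix.of fun a a' => Y (p.1, a) (q.1, a')) := rfl
    rw [Matrix.of_apply, h, map_add]
    rfl
  map_smul' c X := by
    ext p q
    have h : (Matrix.of fun a a' => (c • X) (p.1, a) (q.1, a')) =
        c • (Matrix.of fun a a' => X (p.1, a) (q.1, a')) := rfl
    rw [Matrix.of_apply, h, map_smul]
    rfl

/-- Complete positivity. -/
def IsCompletelyPositive {A B : Type*} (Φ : MatMap A B) : Prop :=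
  ∀ (k : ℕ) (X : Matrix (Fin k × A) (Fin k × A) ℂ),
    X.PosSemidef → (ampliate (Fin k) Φ X).PosSemidef

/-- Quantum channels: completely positive, trace-preserving maps. -/
def IsChannel {A B : Type*} [Fintype A] [Fintype B] (Φ : MatMap A B) : Prop :=
  IsCompletelyPositive Φ ∧ ∀ X : Matrix A A ℂ, (Φ X).trace = X.trace

/-- The map `X ↦ V X V†`. -/
def conjMap {A B : Type*} [Fintype A] (V : Matrix B A ℂ) : MatMap A B where
  toFun X := V * X * V.conjTranspose
  map_add' X Y := by rw [Matrix.mul_add, Matrix.add_mul]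
  map_smul' c X := by simp

/-- `V` is the matrix of an isometry, `V† V = 1`. -/
def IsIsometry {A B : Type*} [Fintype B] [DecidableEq A] (V : Matrix B A ℂ) : Prop :=
  V.conjTranspose * V = 1

/-- Isometry channels, `ρ ↦ V ρ V†` with `V† V = 1`. -/
def IsIsometryChannel {A B : Type*} [Fintype A] [Fintype B] [DecidableEq A]
    (Φ : MatMap A B) : Prop :=
  ∃ V : Matrix B A ℂ, IsIsometry V ∧ Φ = conjMap V

/-- Density matrices. -/
def IsState {B : Type*} [Fintype B] (ρ : Matrix B B ℂ) : Prop :=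
  ρ.PosSemidef ∧ ρ.trace = 1

/-- Pure states, `|v⟩⟨v|` for a unit vector `v`. -/
def IsPureState {B : Type*} [Fintype B] (ψ : Matrix B B ℂ) : Prop :=
  ∃ v : B → ℂ, star v ⬝ᵥ v = 1 ∧ ψ = Matrix.vecMulVec v (star v)

/-- The uniform (maximally mixed) state `1 / |B|`. -/
noncomputable def uniformState (B : Type*) [Fintype B] [DecidableEq B] : Matrix B B ℂ :=
  (Fintype.card B : ℂ)⁻¹ • (1 : Matrix B B ℂ)

/-- A state seen as a channel with trivial (one-dimensional) input system. -/
def stateChannel {B : Type*} (ρ : Matrix B B ℂ) : MatMap Unit B where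
  toFun X := X () () • ρ
  map_add' X Y := by rw [Matrix.add_apply, add_smul]
  map_smul' c X := by rw [Matrix.smul_apply, smul_assoc, RingHom.id_apply]

/-- The channel `Φ ⊗ u^{B'}` from `A` to `B ⊗ B'`, where the uniform state `u^{B'}` is a channel
with trivial input: `X ↦ Φ X ⊗ u^{B'}`. -/
noncomputable def tensorUniform (B' : Type*) [Fintype B'] [DecidableEq B'] {A B : Type*}
    (Φ : MatMap A B) : MatMap A (B × B') where
  toFun X := Φ X ⊗ₖ uniformState B'
  map_add' X Y := by rw [map_add, Matrix.add_kronecker]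
  map_smul' c X := by rw [map_smul, Matrix.smul_kronecker, RingHom.id_apply]

/-- The map `E_τ : X ↦ E (τ ⊗ X)`. -/
def withSide {R B B₁ : Type*} (E : MatMap (R × B) B₁) (τ : Matrix R R ℂ) : MatMap B B₁ where
  toFun X := E (τ ⊗ₖ X)
  map_add' X Y := by rw [Matrix.kronecker_add, map_add]
  map_smul' c X := by rw [Matrix.kronecker_smul, map_smul, RingHom.id_apply]

/-- Doubly stochastic channels: unital channels. -/
def IsDoublyStochastic {B : Type*} [Fintype B] [DecidableEq B] (Φ : MatMap B B) : Prop :=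
  IsChannel Φ ∧ Φ 1 = 1

/-- Conditionally unital channels `E : RB → B`: for every state `τ` of `R`, the map
`X ↦ E (τ ⊗ X)` is a doubly stochastic channel. -/
def IsConditionallyUnital {R B : Type*} [Fintype R] [Fintype B] [DecidableEq B]
    (E : MatMap (R × B) B) : Prop :=
  IsChannel E ∧ ∀ τ : Matrix R R ℂ, IsState τ → IsDoublyStochastic (withSide E τ)

/-- The supermap `N ↦ E ∘ (id_R ⊗ N) ∘ V` with preprocessing `V : A' → RA` and
postprocessing `E : RB → B`. As usual for superchannels, it acts on all linear maps. -/
def superMap {R A A' B : Type*} [Fintype A'] (E : MatMap (R × B) B)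
    (V : Matrix (R × A) A' ℂ) : MatMap A B → MatMap A' B :=
  fun N => E ∘ₗ ampliate R N ∘ₗ conjMap V

/-- `Θ` is realized with an auxiliary system of dimension `r`, the channel `E : RB → B` and the
isometry `V : A' → RA`. -/
def IsRealization {A A' B : Type*} [Fintype A] [Fintype A'] [Fintype B] [DecidableEq A']
    (Θ : MatMap A B → MatMap A' B) (r : ℕ) (E : MatMap (Fin r × B) B)
    (V : Matrix (Fin r × A) A' ℂ) : Prop :=
  IsChannel E ∧ IsIsometry V ∧ Θ = superMap E V

/-- A standard form of a superchannel is a realization in which the dimension of the auxiliary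
system is the smallest possible one. -/
def IsStandardForm {A A' B : Type*} [Fintype A] [Fintype A'] [Fintype B] [DecidableEq A']
    (Θ : MatMap A B → MatMap A' B) (r : ℕ) (E : MatMap (Fin r × B) B)
    (V : Matrix (Fin r × A) A' ℂ) : Prop :=
  IsRealization Θ r E V ∧
    ∀ (r' : ℕ) (E' : MatMap (Fin r' × B) B) (V' : Matrix (Fin r' × A) A' ℂ),
      IsRealization Θ r' E' V' → r ≤ r'

/-- Mixing superchannels: superchannels that have a standard form with conditionally unital
postprocessing. -/
def IsMixing {A A' B : Type*} [Fintype A] [Fintype A'] [Fintype B] [DecidableEq A']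
    [DecidableEq B] (Θ : MatMap A B → MatMap A' B) : Prop :=
  ∃ (r : ℕ) (E : MatMap (Fin r × B) B) (V : Matrix (Fin r × A) A' ℂ),
    IsStandardForm Θ r E V ∧ IsConditionallyUnital E

/-- Channel majorization `N ≻ M` for channels with the same output system. -/
def Majorizes {A A' B : Type*} [Fintype A] [Fintype A'] [Fintype B] [DecidableEq A']
    [DecidableEq B] (N : MatMap A B) (M : MatMap A' B) : Prop :=
  ∃ Θ : MatMap A B → MatMap A' B, IsMixing Θ ∧ M = Θ N

/-- Equivalence under channel majorization, `N ∼ M`. -/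
def Equivalent {A A' B : Type*} [Fintype A] [Fintype A'] [Fintype B] [DecidableEq A]
    [DecidableEq A'] [DecidableEq B] (N : MatMap A B) (M : MatMap A' B) : Prop :=
  Majorizes N M ∧ Majorizes M N

end ChannelMajorization

open ChannelMajorization

/-!
The Choi matrix of `𝒱 ⊗ u^{B'}` is `s = |A| / |B'|` times a projection `P`, and that of a pure state
is `1` times a projection. Let `𝒩` be any channel whose Choi matrix is `s P`, and let `𝒯` be a
channel with the same output whose Choi matrix is at most `s`; the dimension conditions put
`ℳ ⊗ u^{D'}` in this position, because a channel on `C` has Choi matrix of trace `|C|`. To turn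
`𝒩` into `𝒯`, send half of a maximally entangled state through `𝒩` and measure `{P, 1 - P}` on the
resulting Choi state. The first outcome is certain, and after it `𝒯` is applied to the actual
input. After the second outcome, which never occurs with `𝒩` in place, a channel `𝒮` is applied.
When the output of `𝒩` is replaced by the operator `1`, the two outcomes have weights `s⁻¹` and
`|O| - s⁻¹`, where `O` is the output system, so the postprocessing is conditionally unital as soon
as `s⁻¹ 𝒯 + (|O| - s⁻¹) 𝒮 = tr(·) 1`; the bound on the Choi matrix of `𝒯` is exactly what makes this
`𝒮` completely positive.

The realization has an auxiliary system of minimal dimension: probing a superchannel with maps of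
the form `X ↦ X a' a • |b⟩⟨b|` recovers the Gram matrix of its preprocessing `V`, seen as an
operator from `A ⊗ A'` to `R`, and the rank of this operator is a lower bound for `|R|` in every
realization.
-/

namespace ChannelMajorization

open scoped MatrixOrder

section Choi

variable {A B : Type*} [DecidableEq A]

/-- The (unnormalized) Choi matrix `∑ |a⟩⟨a'| ⊗ Φ(|a⟩⟨a'|)`, as a linear function of `Φ`. -/
def choi : MatMap A B →ₗ[ℂ] Matrix (A × B) (A × B) ℂ where
  toFun Φ := Matrix.of fun p q => Φ (Matrix.single p.1 q.1 1) p.2 q.2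
  map_add' _ _ := rfl
  map_smul' _ _ := rfl

theorem choi_apply (Φ : MatMap A B) (p q : A × B) :
    choi Φ p q = Φ (Matrix.single p.1 q.1 1) p.2 q.2 := rfl

theorem map_apply_eq_sum_choi [Fintype A] (Φ : MatMap A B) (X : Matrix A A ℂ) (b b' : B) :
    Φ X b b' = ∑ a, ∑ a', X a a' * choi Φ (a, b) (a', b') := by
  conv_lhs => rw [Matrix.matrix_eq_sum_single X]
  simp only [map_sum, Matrix.sum_apply]
  refine Finset.sum_congr rfl fun a _ => Finset.sum_congr rfl fun a' _ => ?_
  rw [choi_apply, ← smul_eq_mul, ← Matrix.smul_apply, ← map_smul, Matrix.smul_single, smul_eq_mul,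
    mul_one]

theorem choi_injective [Finite A] :
    Function.Injective (choi : MatMap A B →ₗ[ℂ] Matrix (A × B) (A × B) ℂ) := by
  cases nonempty_fintype A
  refine (injective_iff_map_eq_zero _).2 fun Φ h => LinearMap.ext fun X => ?_
  ext b b'
  simp [map_apply_eq_sum_choi Φ, h]

theorem trace_choi [Fintype A] [Fintype B] (Φ : MatMap A B) : (choi Φ).trace = (Φ 1).trace := by
  simp only [Matrix.trace, Matrix.diag, map_apply_eq_sum_choi Φ 1, Fintype.sum_prod_type]
  rw [Finset.sum_comm]
  simp [Matrix.one_apply]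

theorem IsCompletelyPositive.posSemidef_choi [Finite A] {Φ : MatMap A B}
    (h : IsCompletelyPositive Φ) : (choi Φ).PosSemidef := by
  cases nonempty_fintype A
  -- `choi Φ` is the image of the unnormalized maximally entangled state `v v†` under `id ⊗ Φ`.
  let e := Fintype.equivFin A
  let v : Fin (Fintype.card A) × A → ℂ := fun p => if p.1 = e p.2 then 1 else 0
  refine (congrArg Matrix.PosSemidef (Matrix.ext fun p q => ?_)).mpr
    ((h _ _ (Matrix.posSemidef_vecMulVec_self_star v)).submatrix fun p : A × B => (e p.1, p.2))
  refine congrArg (fun Z => Φ Z p.2 q.2) ?_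
  ext a a'
  by_cases ha : p.1 = a <;> by_cases ha' : q.1 = a' <;>
    simp [Matrix.vecMulVec_apply, v, ha, ha']

theorem isCompletelyPositive_of_posSemidef_choi [Finite A] [Finite B] {Φ : MatMap A B}
    (h : (choi Φ).PosSemidef) : IsCompletelyPositive Φ := by
  classical
  cases nonempty_fintype A
  cases nonempty_fintype B
  intro k X hX
  -- `Q` contracts the two copies of `A`, so that `Q (X ⊗ choi Φ) Q†` is `(id ⊗ Φ) X`.
  let Q : Matrix (Fin k × B) ((Fin k × A) × (A × B)) ℂ :=
    Matrix.of fun p q => if p.1 = q.1.1 ∧ p.2 = q.2.2 ∧ q.1.2 = q.2.1 then 1 else 0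
  have hQ := (hX.kronecker h).mul_mul_conjTranspose_same Q
  refine (congrArg Matrix.PosSemidef (Matrix.ext fun p q => ?_)).mpr hQ
  refine (map_apply_eq_sum_choi Φ _ _ _).trans ?_
  simp only [Matrix.mul_apply, Matrix.conjTranspose_apply, Matrix.kroneckerMap_apply, Q,
    Matrix.of_apply, Fintype.sum_prod_type, ite_and, apply_ite star, star_one,
    star_zero, mul_ite, mul_one, mul_zero, ite_mul, one_mul, zero_mul, Finset.sum_ite_eq,
    Finset.mem_univ, if_true, Finset.sum_ite_irrel, Finset.sum_const_zero]
  rw [Finset.sum_comm]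

theorem choi_conjMap [Fintype A] (V : Matrix B A ℂ) :
    choi (conjMap V) =
      Matrix.vecMulVec (fun p => V p.2 p.1) (star fun p : A × B => V p.2 p.1) := by
  ext p q
  change (V * Matrix.single p.1 q.1 (1 : ℂ) * V.conjTranspose) p.2 q.2 = _
  simp [Matrix.mul_apply, Matrix.single_apply, Matrix.vecMulVec_apply, ite_and]

theorem choi_conjMap_comp {O : Type*} [Fintype A] [Fintype B] (W : Matrix O B ℂ)
    (Φ : MatMap A B) :
    choi (conjMap W ∘ₗ Φ) =
      ((1 : Matrix A A ℂ) ⊗ₖ W) * choi Φ * ((1 : Matrix A A ℂ) ⊗ₖ W).conjTranspose := by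
  ext p q
  change (W * Φ (Matrix.single p.1 q.1 1) * W.conjTranspose) p.2 q.2 = _
  simp [Matrix.mul_apply, Matrix.one_apply, Fintype.sum_prod_type, choi_apply, apply_ite star]

theorem choi_tensorUniform (S : Type*) [Fintype S] [DecidableEq S] (Φ : MatMap A B) :
    choi (tensorUniform S Φ) = (choi Φ ⊗ₖ uniformState S).submatrix
      (Equiv.prodAssoc A B S).symm (Equiv.prodAssoc A B S).symm := rfl

theorem choi_stateChannel (ρ : Matrix B B ℂ) :
    choi (stateChannel ρ) = ρ.submatrix Prod.snd Prod.snd := by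
  ext p q
  simp [choi_apply, stateChannel]

end Choi

section Channel

variable {A B C : Type*}

theorem IsCompletelyPositive.comp {Ψ : MatMap B C} {Φ : MatMap A B}
    (hΨ : IsCompletelyPositive Ψ) (hΦ : IsCompletelyPositive Φ) :
    IsCompletelyPositive (Ψ ∘ₗ Φ) :=
  fun k X hX => hΨ k _ (hΦ k X hX)

theorem IsCompletelyPositive.add {Φ Ψ : MatMap A B} (hΦ : IsCompletelyPositive Φ)
    (hΨ : IsCompletelyPositive Ψ) : IsCompletelyPositive (Φ + Ψ) :=
  fun k X hX => (hΦ k X hX).add (hΨ k X hX)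

theorem IsCompletelyPositive.withSide {R : Type*} [Finite R] [Finite B] {E : MatMap (R × B) C}
    (hE : IsCompletelyPositive E) {τ : Matrix R R ℂ} (hτ : τ.PosSemidef) :
    IsCompletelyPositive (withSide E τ) :=
  fun k _ hX => hE k _ ((hτ.kronecker hX).submatrix
    (fun p : Fin k × R × B => (p.2.1, (p.1, p.2.2))))

theorem isCompletelyPositive_conjMap [Fintype A] [Finite B] (V : Matrix B A ℂ) :
    IsCompletelyPositive (conjMap V) := by
  classical
  exact isCompletelyPositive_of_posSemidef_choi <|
    choi_conjMap V ▸ Matrix.posSemidef_vecMulVec_self_star _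

theorem posSemidef_uniformState (S : Type*) [Fintype S] [DecidableEq S] :
    (uniformState S).PosSemidef :=
  Matrix.PosSemidef.one.smul (by positivity)

variable [Fintype A] [Fintype B]

theorem IsChannel.comp [Fintype C] {Ψ : MatMap B C} {Φ : MatMap A B}
    (hΨ : IsChannel Ψ) (hΦ : IsChannel Φ) : IsChannel (Ψ ∘ₗ Φ) :=
  ⟨hΨ.1.comp hΦ.1, fun X => (hΨ.2 _).trans (hΦ.2 X)⟩

theorem IsChannel.withSide [Fintype C] {R : Type*} [Fintype R] {E : MatMap (R × B) C}
    (hE : IsChannel E) {τ : Matrix R R ℂ} (hτ : IsState τ) : IsChannel (withSide E τ) :=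
  ⟨hE.1.withSide hτ.1, fun X =>
    (hE.2 _).trans (by rw [Matrix.trace_kronecker, hτ.2, one_mul])⟩

theorem IsIsometryChannel.isChannel [DecidableEq A] {Φ : MatMap A B}
    (h : IsIsometryChannel Φ) : IsChannel Φ := by
  obtain ⟨V, hV, rfl⟩ := h
  refine ⟨isCompletelyPositive_conjMap V, fun X => ?_⟩
  change (V * X * V.conjTranspose).trace = _
  rw [Matrix.trace_mul_cycle, hV, one_mul]

theorem IsIsometry.card_le [DecidableEq A] {V : Matrix B A ℂ} (hV : IsIsometry V) :
    Fintype.card A ≤ Fintype.card B := by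
  rw [← Matrix.rank_one (R := ℂ) (n := A), ← hV, Matrix.rank_conjTranspose_mul_self]
  exact V.rank_le_card_height

theorem IsChannel.tensorUniform {Φ : MatMap A B} (hΦ : IsChannel Φ) (S : Type*) [Fintype S]
    [DecidableEq S] [Nonempty S] : IsChannel (tensorUniform S Φ) := by
  classical
  refine ⟨isCompletelyPositive_of_posSemidef_choi ?_, fun X => ?_⟩
  · rw [choi_tensorUniform]
    exact (hΦ.1.posSemidef_choi.kronecker (posSemidef_uniformState S)).submatrix _
  · change (Φ X ⊗ₖ uniformState S).trace = _
    simp [Matrix.trace_kronecker, uniformState, hΦ.2]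

theorem IsPureState.isState {ψ : Matrix B B ℂ} (h : IsPureState ψ) : IsState ψ := by
  obtain ⟨v, hv, rfl⟩ := h
  refine ⟨Matrix.posSemidef_vecMulVec_self_star v, ?_⟩
  rw [Matrix.trace_vecMulVec, dotProduct_comm, hv]

theorem IsState.isChannel_stateChannel {ρ : Matrix B B ℂ} (h : IsState ρ) :
    IsChannel (stateChannel ρ) := by
  refine ⟨isCompletelyPositive_of_posSemidef_choi ?_, fun X => ?_⟩
  · rw [choi_stateChannel]
    exact h.1.submatrix _
  · change (X () () • ρ).trace = _
    rw [Matrix.trace_smul, h.2]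
    simp [Matrix.trace]

theorem IsIsometry.submatrix_equiv {V : Matrix B C ℂ} [DecidableEq C] (hV : IsIsometry V)
    (e : A ≃ B) : IsIsometry (V.submatrix e id) := by
  unfold IsIsometry at hV ⊢
  rw [Matrix.conjTranspose_submatrix, Matrix.submatrix_mul_equiv, hV, Matrix.submatrix_id_id]

/-- The relabelling of the basis of a system along a bijection, as a map of operators. -/
def reindexMap (e : A ≃ B) : MatMap A B := (Matrix.reindexLinearEquiv ℂ ℂ e e).toLinearMap

theorem isChannel_reindexMap (e : A ≃ B) : IsChannel (reindexMap e) :=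
  ⟨fun k _ hX => hX.submatrix fun p : Fin k × B => (p.1, e.symm p.2),
    fun X => Equiv.sum_comp e.symm fun i => X i i⟩

end Channel

section ChannelChoi

theorem posSemidef_le_trace_smul_one {n : Type*} [Fintype n] [DecidableEq n]
    {M : Matrix n n ℂ} (hM : M.PosSemidef) : M ≤ M.trace • 1 := by
  have htrace : M.trace • (1 : Matrix n n ℂ) =
      algebraMap ℝ (Matrix n n ℂ) (∑ i, hM.1.eigenvalues i) := by
    rw [hM.1.trace_eq_sum_eigenvalues, Algebra.algebraMap_eq_smul_one, ← Complex.coe_smul]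
    push_cast
    rfl
  rw [htrace]
  refine le_algebraMap_of_spectrum_le (fun x hx => ?_) hM.1
  obtain ⟨i, rfl⟩ := hM.1.spectrum_real_eq_range_eigenvalues ▸ hx
  exact Finset.single_le_sum (fun j _ => hM.eigenvalues_nonneg j) (Finset.mem_univ i)

variable {A B : Type*} [DecidableEq A]

theorem IsChannel.sum_choi_apply [Fintype A] [Fintype B] {Φ : MatMap A B} (hΦ : IsChannel Φ)
    (a a' : A) : ∑ b, choi Φ (a, b) (a', b) = (1 : Matrix A A ℂ) a a' := by
  refine (hΦ.2 (Matrix.single a a' 1)).trans ?_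
  obtain rfl | h := eq_or_ne a a'
  · rw [Matrix.trace_single_eq_same, Matrix.one_apply_eq]
  · rw [Matrix.trace_single_eq_of_ne _ _ _ h, Matrix.one_apply_ne h]

variable [DecidableEq B]

theorem IsChannel.choi_le [Fintype A] [Fintype B] {Φ : MatMap A B} (hΦ : IsChannel Φ) :
    choi Φ ≤ (Fintype.card A : ℂ) • 1 := by
  have h := posSemidef_le_trace_smul_one hΦ.1.posSemidef_choi
  rwa [trace_choi, hΦ.2, Matrix.trace_one] at h

theorem choi_tensorUniform_le [Finite A] [Finite B] {Φ : MatMap A B} {s : ℂ}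
    (hΦ : choi Φ ≤ s • 1) (S : Type*) [Fintype S] [DecidableEq S] :
    choi (tensorUniform S Φ) ≤ (s / Fintype.card S) • 1 := by
  have h := ((Matrix.le_iff.1 hΦ).kronecker (posSemidef_uniformState S)).submatrix
    (Equiv.prodAssoc A B S).symm
  refine Matrix.le_iff.2 ((congrArg Matrix.PosSemidef ?_).mpr h)
  ext p q
  by_cases h : p.2.2 = q.2.2 <;>
    simp [choi_tensorUniform, uniformState, Matrix.one_apply, Prod.ext_iff, sub_mul, ite_and,
      div_eq_mul_inv, h]

end ChannelChoi

section StandardForm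

variable {R A A' B : Type*}

/-- The isometry `V : A' → R ⊗ A` with the system `A` moved to the input side, so that the rank of
`rowMatrix V` is the dimension of the part of `R` that `V` actually uses. -/
def rowMatrix (V : Matrix (R × A) A' ℂ) : Matrix R (A × A') ℂ :=
  Matrix.of fun r p => V (r, p.1) p.2

variable [Fintype A']

theorem superMap_reindex {Q : Type*} (e : Q ≃ R) (E : MatMap (R × B) B)
    (V : Matrix (R × A) A' ℂ) :
    superMap (E ∘ₗ reindexMap (e.prodCongr (Equiv.refl B)))
      (V.submatrix (e.prodCongr (Equiv.refl A)) id) = superMap E V := by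
  funext N
  refine LinearMap.ext fun X => congrArg E ?_
  ext ⟨r, b⟩ ⟨r', b'⟩
  change N (Matrix.of fun a a' => conjMap V X (e (e.symm r), a) (e (e.symm r'), a')) b b' =
    N (Matrix.of fun a a' => conjMap V X (r, a) (r', a')) b b'
  simp only [Equiv.apply_symm_apply]

variable [Fintype B]

theorem trace_superMap [Fintype R] {E : MatMap (R × B) B} (hE : IsChannel E)
    (V : Matrix (R × A) A' ℂ) (N : MatMap A B) (X : Matrix A' A' ℂ) :
    (superMap E V N X).trace =
      ∑ r, (N (Matrix.of fun a a' => conjMap V X (r, a) (r, a'))).trace :=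
  (hE.2 _).trans (Fintype.sum_prod_type _)

theorem trace_superMap_single [DecidableEq A'] [DecidableEq B] [Fintype R] {E : MatMap (R × B) B}
    (hE : IsChannel E) (V : Matrix (R × A) A' ℂ) (a a' : A) (x x' : A') (b : B) :
    (superMap E V ((Matrix.entryLinearMap ℂ ℂ a' a).smulRight (Matrix.single b b 1))
      (Matrix.single x' x 1)).trace =
        ((rowMatrix V).conjTranspose * rowMatrix V) (a, x) (a', x') := by
  rw [trace_superMap hE, Matrix.mul_apply]
  refine Finset.sum_congr rfl fun r _ => ?_
  change (((V * Matrix.single x' x (1 : ℂ) * V.conjTranspose) (r, a') (r, a)) •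
    Matrix.single b b (1 : ℂ)).trace = star (V (r, a) x) * V (r, a') x'
  rw [Matrix.trace_smul, Matrix.trace_single_eq_same]
  simp [Matrix.mul_apply, Matrix.single_apply, ite_and, mul_comm]

theorem rowMatrix_gram_eq_of_superMap_eq [Nonempty B] {R' : Type*} [Fintype R] [Fintype R']
    {E : MatMap (R × B) B} {E' : MatMap (R' × B) B} (hE : IsChannel E) (hE' : IsChannel E')
    {V : Matrix (R × A) A' ℂ} {V' : Matrix (R' × A) A' ℂ} (h : superMap E V = superMap E' V') :
    (rowMatrix V).conjTranspose * rowMatrix V = (rowMatrix V').conjTranspose * rowMatrix V' := by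
  classical
  obtain ⟨b⟩ := ‹Nonempty B›
  ext ⟨a, x⟩ ⟨a', x'⟩
  rw [← trace_superMap_single hE V a a' x x' b, ← trace_superMap_single hE' V' a a' x x' b, h]

theorem IsRealization.isStandardForm [Nonempty B] [Fintype A] [DecidableEq A']
    {Θ : MatMap A B → MatMap A' B} {r : ℕ} {E : MatMap (Fin r × B) B}
    {V : Matrix (Fin r × A) A' ℂ} (h : IsRealization Θ r E V) (hV : (rowMatrix V).rank = r) :
    IsStandardForm Θ r E V := by
  refine ⟨h, fun r' E' V' h' => ?_⟩
  have hgram := rowMatrix_gram_eq_of_superMap_eq h.1 h'.1 (h.2.2.symm.trans h'.2.2)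
  have hrank := congrArg Matrix.rank hgram
  rw [Matrix.rank_conjTranspose_mul_self, Matrix.rank_conjTranspose_mul_self, hV] at hrank
  rw [hrank]
  simpa only [Fintype.card_fin] using (rowMatrix V').rank_le_card_height

theorem IsConditionallyUnital.reindex {Q : Type*} [Fintype R] [Fintype Q] [DecidableEq B]
    {E : MatMap (R × B) B} (hE : IsConditionallyUnital E) (e : Q ≃ R) :
    IsConditionallyUnital (E ∘ₗ reindexMap (e.prodCongr (Equiv.refl B))) := by
  have hchannel := hE.1.comp (isChannel_reindexMap (e.prodCongr (Equiv.refl B)))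
  refine ⟨hchannel, fun τ hτ => ⟨hchannel.withSide hτ, ?_⟩⟩
  have hτ' : IsState (reindexMap e τ) :=
    ⟨hτ.1.submatrix _, ((isChannel_reindexMap e).2 τ).trans hτ.2⟩
  exact (hE.2 _ hτ').2

theorem isMixing_superMap [Nonempty B] [Fintype R] [Fintype A] [DecidableEq A'] [DecidableEq B]
    {E : MatMap (R × B) B} (hE : IsConditionallyUnital E) {V : Matrix (R × A) A' ℂ}
    (hV : IsIsometry V) (hrank : (rowMatrix V).rank = Fintype.card R) :
    IsMixing (superMap E V) := by
  let e := (Fintype.equivFin R).symm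
  have hE' := hE.reindex e
  have hreal : IsRealization (superMap E V) _ _ _ :=
    ⟨hE'.1, hV.submatrix_equiv (e.prodCongr (Equiv.refl A)), (superMap_reindex e E V).symm⟩
  refine ⟨_, _, _, hreal.isStandardForm ?_, hE'⟩
  exact ((rowMatrix V).rank_submatrix e (Equiv.refl _)).trans hrank

end StandardForm

section MaximallyEntangled

theorem inv_sqrt_card_mul_self (A : Type*) [Fintype A] :
    ((√(Fintype.card A))⁻¹ : ℂ) * ((√(Fintype.card A))⁻¹ : ℂ) = (Fintype.card A : ℂ)⁻¹ := by
  rw [← mul_inv, ← Complex.ofReal_mul, Real.mul_self_sqrt (by positivity), Complex.ofReal_natCast]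

variable (C A : Type*) [Fintype A] [DecidableEq A] [DecidableEq C]

/-- The isometry `|c⟩ ↦ |c⟩ ⊗ |Φ⟩` from `C` to `(C ⊗ A) ⊗ A` that appends the maximally entangled
state `Φ = |A|^(-1/2) ∑ |a⟩ ⊗ |a⟩`. -/
noncomputable def appendEntangled : Matrix ((C × A) × A) C ℂ :=
  Matrix.of fun p c =>
    ((√(Fintype.card A))⁻¹ : ℂ) * (1 : Matrix (C × A) (C × A) ℂ) p.1 (c, p.2)

theorem appendEntangled_apply (p : (C × A) × A) (c : C) : appendEntangled C A p c =
    ((√(Fintype.card A))⁻¹ : ℂ) * (1 : Matrix (C × A) (C × A) ℂ) p.1 (c, p.2) := rfl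

theorem rowMatrix_appendEntangled : rowMatrix (appendEntangled C A) =
    ((√(Fintype.card A))⁻¹ : ℂ) •
      (1 : Matrix (C × A) (C × A) ℂ).submatrix (Equiv.refl _) (Equiv.prodComm A C) := rfl

variable [Fintype C]

theorem rank_rowMatrix_appendEntangled [Nonempty A] :
    (rowMatrix (appendEntangled C A)).rank = Fintype.card (C × A) := by
  have hc : ((√(Fintype.card A))⁻¹ : ℂ) ≠ 0 := by simp
  rw [rowMatrix_appendEntangled,
    Matrix.rank_smul_of_mem_nonZeroDivisors _ (mem_nonZeroDivisors_of_ne_zero hc),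
    Matrix.rank_submatrix, Matrix.rank_one]

theorem conjMap_appendEntangled_apply (X : Matrix C C ℂ) (p q : (C × A) × A) :
    conjMap (appendEntangled C A) X p q = (Fintype.card A : ℂ)⁻¹ *
      (X p.1.1 q.1.1 * Matrix.single p.1.2 q.1.2 (1 : ℂ) p.2 q.2) := by
  change (appendEntangled C A * X * (appendEntangled C A).conjTranspose) p q = _
  rw [← inv_sqrt_card_mul_self A]
  obtain ⟨⟨c, a⟩, i⟩ := p
  obtain ⟨⟨c', a'⟩, j⟩ := q
  by_cases hi : a = i <;> by_cases hj : a' = j <;>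
    simp [Matrix.mul_apply, appendEntangled_apply, Matrix.one_apply, apply_ite star, hi, hj]
  ring

theorem isIsometry_appendEntangled [Nonempty A] : IsIsometry (appendEntangled C A) := by
  unfold IsIsometry
  ext c c'
  have hA : (Fintype.card A : ℂ) ≠ 0 := by simp
  by_cases h : c = c'
  · subst h
    simp [Matrix.mul_apply, appendEntangled_apply, Fintype.sum_prod_type, Matrix.one_apply,
      ite_and, apply_ite star, inv_sqrt_card_mul_self, hA]
  · simp [Matrix.mul_apply, appendEntangled_apply, Fintype.sum_prod_type, Matrix.one_apply,
      ite_and, apply_ite star, h, Ne.symm h]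

variable {C A}

theorem reindexMap_ampliate_appendEntangled {O : Type*} (N : MatMap A O) (X : Matrix C C ℂ) :
    reindexMap (Equiv.prodAssoc C A O)
        (ampliate (C × A) N (conjMap (appendEntangled C A) X)) =
      (Fintype.card A : ℂ)⁻¹ • (X ⊗ₖ choi N) := by
  ext ⟨c, a, o⟩ ⟨c', a', o'⟩
  have hblock : (Matrix.of fun i j =>
      conjMap (appendEntangled C A) X ((c, a), i) ((c', a'), j)) =
      ((Fintype.card A : ℂ)⁻¹ * X c c') • Matrix.single a a' (1 : ℂ) := by
    ext i j
    exact (conjMap_appendEntangled_apply ..).trans (mul_assoc ..).symm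
  change N (Matrix.of fun i j =>
    conjMap (appendEntangled C A) X ((c, a), i) ((c', a'), j)) o o' =
    _ * (X c c' * choi N (a, o) (a', o'))
  rw [hblock, map_smul, Matrix.smul_apply, smul_eq_mul, mul_assoc]
  rfl

end MaximallyEntangled

section Complement

variable {C O : Type*} [Fintype C] [DecidableEq O]

/-- The completely depolarizing map `X ↦ tr(X) 1`, whose Choi matrix is the identity. -/
def traceOne (C O : Type*) [Fintype C] [DecidableEq O] : MatMap C O :=
  (Matrix.traceLinearMap C ℂ ℂ).smulRight 1

theorem traceOne_apply (X : Matrix C C ℂ) : traceOne C O X = X.trace • 1 := rfl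

theorem choi_traceOne [DecidableEq C] : choi (traceOne C O) = 1 := by
  ext p q
  by_cases h : p.1 = q.1 <;>
    simp [choi_apply, traceOne_apply, Matrix.one_apply, Prod.ext_iff, h]

theorem posSemidef_choi_traceOne_sub_smul [DecidableEq C] {T : MatMap C O} {s : ℂ} (hs : 0 < s)
    (h : choi T ≤ s • 1) : (choi (traceOne C O - s⁻¹ • T)).PosSemidef := by
  have hscaled := (Matrix.le_iff.1 h).smul (inv_nonneg.2 hs.le)
  rwa [smul_sub, smul_smul, inv_mul_cancel₀ hs.ne', one_smul, ← choi_traceOne (C := C), ← map_smul,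
    ← map_sub] at hscaled

variable [Fintype O]

theorem trace_traceOne_sub_smul {T : MatMap C O} (hT : IsChannel T) (t : ℂ) (X : Matrix C C ℂ) :
    ((traceOne C O - t • T) X).trace = (Fintype.card O - t) * X.trace := by
  simp only [LinearMap.sub_apply, LinearMap.smul_apply, traceOne_apply, Matrix.trace_sub,
    Matrix.trace_smul, Matrix.trace_one, hT.2, smul_eq_mul]
  ring

theorem IsChannel.exists_complement [Nonempty C] [DecidableEq C] {T : MatMap C O} (hT : IsChannel T)
    {s : ℂ} (hs : 0 < s) (h : choi T ≤ s • 1) :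
    ∃ S : MatMap C O, IsChannel S ∧ traceOne C O = s⁻¹ • T + (Fintype.card O - s⁻¹) • S := by
  set κ : ℂ := Fintype.card O - s⁻¹
  have hpos := posSemidef_choi_traceOne_sub_smul hs h
  have htrace : (choi (traceOne C O - s⁻¹ • T)).trace = κ * Fintype.card C := by
    rw [trace_choi, trace_traceOne_sub_smul hT, Matrix.trace_one]
  rcases eq_or_ne κ 0 with hκ | hκ
  · -- Here `s⁻¹ T` alone is `tr(·) 1`: a positive semidefinite matrix of trace zero vanishes.
    have hzero : traceOne C O - s⁻¹ • T = 0 := choi_injective <| by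
      rw [map_zero, ← hpos.trace_eq_zero_iff, htrace, hκ, zero_mul]
    exact ⟨T, hT, by rw [hκ, zero_smul, add_zero, sub_eq_zero.1 hzero]⟩
  · have hκ_nonneg : 0 ≤ κ := by
      have hC : (0 : ℂ) < Fintype.card C := by exact_mod_cast Fintype.card_pos
      refine le_of_mul_le_mul_right ?_ hC
      rw [zero_mul, ← htrace]
      exact hpos.trace_nonneg
    refine ⟨κ⁻¹ • (traceOne C O - s⁻¹ • T),
      ⟨isCompletelyPositive_of_posSemidef_choi ?_, fun X => ?_⟩, ?_⟩
    · rw [map_smul]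
      exact hpos.smul (inv_nonneg.2 hκ_nonneg)
    · rw [LinearMap.smul_apply, Matrix.trace_smul, trace_traceOne_sub_smul hT, smul_eq_mul,
        inv_mul_cancel_left₀ hκ]
    · rw [smul_inv_smul₀ hκ, add_sub_cancel]

end Complement

section Branch

variable {C K : Type*} [Fintype K]

/-- The map `X ↦ tr_K ((1 ⊗ G) X)`: the outcome with effect `G` of a measurement of `K`. -/
def weightedTrace (C : Type*) (G : Matrix K K ℂ) : MatMap (C × K) C where
  toFun X := Matrix.of fun c c' => (G * Matrix.of fun k k' => X (c, k) (c', k')).trace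
  map_add' X Y := by
    ext c c'
    exact (congrArg Matrix.trace (G.mul_add _ _)).trans (Matrix.trace_add _ _)
  map_smul' z X := by
    ext c c'
    exact (congrArg Matrix.trace (G.mul_smul z _)).trans (Matrix.trace_smul _ _)

theorem weightedTrace_apply (G : Matrix K K ℂ) (X : Matrix (C × K) (C × K) ℂ) (c c' : C) :
    weightedTrace C G X c c' = (G * Matrix.of fun k k' => X (c, k) (c', k')).trace := rfl

theorem weightedTrace_kronecker (G : Matrix K K ℂ) (X : Matrix C C ℂ) (Y : Matrix K K ℂ) :
    weightedTrace C G (X ⊗ₖ Y) = (G * Y).trace • X := by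
  ext c c'
  rw [Matrix.smul_apply, smul_eq_mul, mul_comm, ← smul_eq_mul, ← Matrix.trace_smul,
    ← Matrix.mul_smul]
  rfl

theorem isCompletelyPositive_weightedTrace [Finite C] {G : Matrix K K ℂ} (hG : G.PosSemidef) :
    IsCompletelyPositive (weightedTrace C G) := by
  classical
  cases nonempty_fintype C
  let v : C × C → ℂ := fun p => (1 : Matrix C C ℂ) p.1 p.2
  refine isCompletelyPositive_of_posSemidef_choi <| (congrArg Matrix.PosSemidef ?_).mpr
    (((Matrix.posSemidef_vecMulVec_self_star v).kronecker hG.transpose).submatrix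
      fun p : (C × K) × C => ((p.1.1, p.2), p.1.2))
  ext ⟨⟨c, k⟩, d⟩ ⟨⟨c', k'⟩, d'⟩
  rw [choi_apply, weightedTrace_apply]
  by_cases h : c = d <;> by_cases h' : c' = d' <;>
    simp [v, Matrix.trace, Matrix.mul_apply, Matrix.single_apply, Matrix.vecMulVec_apply,
      Matrix.one_apply, ite_and, h, h']

theorem weightedTrace_add (G H : Matrix K K ℂ) :
    weightedTrace C (G + H) = weightedTrace C G + weightedTrace C H := by
  refine LinearMap.ext fun X => ?_
  ext c c'
  exact (congrArg Matrix.trace (Matrix.add_mul ..)).trans (Matrix.trace_add _ _)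

theorem trace_weightedTrace_one [Fintype C] [DecidableEq K] (X : Matrix (C × K) (C × K) ℂ) :
    (weightedTrace C 1 X).trace = X.trace := by
  simp only [Matrix.trace, Matrix.diag, Fintype.sum_prod_type, weightedTrace_apply, one_mul,
    Matrix.of_apply]

theorem weightedTrace_reindexMap_kronecker_one {A O : Type*} [Fintype A] [Fintype O]
    [DecidableEq A] [DecidableEq O] {G : Matrix (A × O) (A × O) ℂ} {g : ℂ}
    (hG : ∀ a a', ∑ o, G (a, o) (a', o) = g * (1 : Matrix A A ℂ) a a')
    (τ : Matrix (C × A) (C × A) ℂ) :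
    weightedTrace C G (reindexMap (Equiv.prodAssoc C A O) (τ ⊗ₖ 1)) =
      g • weightedTrace C 1 τ := by
  ext c c'
  have hentry (a : A) (o : O) (a' : A) (o' : O) :
      reindexMap (Equiv.prodAssoc C A O) (τ ⊗ₖ 1) (c, a, o) (c', a', o') =
        τ (c, a) (c', a') * (1 : Matrix O O ℂ) o o' := rfl
  calc weightedTrace C G (reindexMap (Equiv.prodAssoc C A O) (τ ⊗ₖ 1)) c c'
      = ∑ a, ∑ o, ∑ a', G (a, o) (a', o) * τ (c, a') (c', a) := by
        simp [weightedTrace_apply, Matrix.trace, Matrix.mul_apply, Fintype.sum_prod_type, hentry,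
          Matrix.one_apply]
    _ = ∑ a, ∑ a', (∑ o, G (a, o) (a', o)) * τ (c, a') (c', a) := by
        simp only [Finset.sum_mul]
        exact Finset.sum_congr rfl fun a _ => Finset.sum_comm
    _ = (g • weightedTrace C 1 τ) c c' := by
        simp [hG, weightedTrace_apply, Matrix.trace, Matrix.one_apply, Finset.mul_sum]

variable {O : Type*} [DecidableEq K]

/-- The two-outcome measurement `{G, 1 - G}` of `K`, followed by `T` after the first outcome and by
`S` after the second. -/
def branch (G : Matrix K K ℂ) (T S : MatMap C O) : MatMap (C × K) O :=
  T ∘ₗ weightedTrace C G + S ∘ₗ weightedTrace C (1 - G)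

theorem branch_apply (G : Matrix K K ℂ) (T S : MatMap C O) (X : Matrix (C × K) (C × K) ℂ) :
    branch G T S X = T (weightedTrace C G X) + S (weightedTrace C (1 - G) X) := rfl

theorem isChannel_branch [Fintype C] [Fintype O] {G : Matrix K K ℂ} (hG : 0 ≤ G) (hG' : G ≤ 1)
    {T S : MatMap C O} (hT : IsChannel T) (hS : IsChannel S) : IsChannel (branch G T S) := by
  refine ⟨(hT.1.comp (isCompletelyPositive_weightedTrace (Matrix.nonneg_iff_posSemidef.1 hG))).add
    (hS.1.comp (isCompletelyPositive_weightedTrace (Matrix.le_iff.1 hG'))), fun X => ?_⟩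
  rw [branch_apply, Matrix.trace_add, hT.2, hS.2, ← Matrix.trace_add, ← LinearMap.add_apply,
    ← weightedTrace_add, add_sub_cancel, trace_weightedTrace_one]

end Branch

section FlatChannel

variable {A C O : Type*} [DecidableEq A] [Fintype A] [Fintype O]

/-- All nonzero eigenvalues of the Choi matrix of `Φ` are equal to `s`: the Choi matrix is `s` times
a projection. -/
def IsFlat (s : ℂ) (Φ : MatMap A O) : Prop := choi Φ * choi Φ = s • choi Φ

variable {s : ℂ} {N : MatMap A O}

theorem IsChannel.sum_inv_smul_choi (hN : IsChannel N) (s : ℂ) (a a' : A) :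
    ∑ o, (s⁻¹ • choi N) (a, o) (a', o) = s⁻¹ * (1 : Matrix A A ℂ) a a' := by
  simp only [Matrix.smul_apply, smul_eq_mul, ← Finset.mul_sum, hN.sum_choi_apply]

theorem IsFlat.isStarProjection (h : IsFlat s N) (hN : IsCompletelyPositive N) (hs : 0 < s) :
    IsStarProjection (s⁻¹ • choi N) where
  isIdempotentElem := by
    rw [IsIdempotentElem, smul_mul_smul_comm, h, smul_smul, mul_assoc, inv_mul_cancel₀ hs.ne',
      mul_one]
  isSelfAdjoint := (hN.posSemidef_choi.smul (inv_nonneg.2 hs.le)).1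

variable [DecidableEq O]

theorem IsChannel.sum_one_sub_inv_smul_choi (hN : IsChannel N) (s : ℂ) (a a' : A) :
    ∑ o, (1 - s⁻¹ • choi N) (a, o) (a', o) =
      (Fintype.card O - s⁻¹) * (1 : Matrix A A ℂ) a a' := by
  have h1 : ∑ o : O, (1 : Matrix (A × O) (A × O) ℂ) (a, o) (a', o) =
      Fintype.card O * (1 : Matrix A A ℂ) a a' := by
    simp [Matrix.one_apply]
  simp only [Matrix.sub_apply, Finset.sum_sub_distrib, hN.sum_inv_smul_choi, h1, sub_mul]

variable {T S : MatMap C O}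

theorem branch_choi_kronecker (hN : IsChannel N) (hs : s ≠ 0) (hflat : IsFlat s N)
    (X : Matrix C C ℂ) :
    branch (s⁻¹ • choi N) T S (X ⊗ₖ choi N) = (Fintype.card A : ℂ) • T X := by
  have hmul : (s⁻¹ • choi N) * choi N = choi N := by
    rw [Matrix.smul_mul, hflat, inv_smul_smul₀ hs]
  rw [branch_apply, weightedTrace_kronecker, weightedTrace_kronecker, Matrix.sub_mul, hmul,
    Matrix.one_mul, sub_self, Matrix.trace_zero, zero_smul, map_zero, add_zero, trace_choi, hN.2,
    Matrix.trace_one, map_smul]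

variable [Fintype C]

theorem isConditionallyUnital_branch (hN : IsChannel N) (hs : 0 < s) (hflat : IsFlat s N)
    (hT : IsChannel T) (hS : IsChannel S)
    (hTS : traceOne C O = s⁻¹ • T + (Fintype.card O - s⁻¹) • S) :
    IsConditionallyUnital
      (branch (s⁻¹ • choi N) T S ∘ₗ reindexMap (Equiv.prodAssoc C A O)) := by
  have hproj := hflat.isStarProjection hN.1 hs
  have hE := (isChannel_branch hproj.nonneg hproj.le_one hT hS).comp
    (isChannel_reindexMap (Equiv.prodAssoc C A O))
  refine ⟨hE, fun τ hτ => ⟨hE.withSide hτ, ?_⟩⟩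
  calc branch (s⁻¹ • choi N) T S (reindexMap (Equiv.prodAssoc C A O) (τ ⊗ₖ 1))
      = (s⁻¹ • T + (Fintype.card O - s⁻¹) • S) (weightedTrace C 1 τ) := by
        rw [branch_apply, weightedTrace_reindexMap_kronecker_one (hN.sum_inv_smul_choi s),
          weightedTrace_reindexMap_kronecker_one (hN.sum_one_sub_inv_smul_choi s), map_smul,
          map_smul]
        rfl
    _ = 1 := by
        rw [← hTS, traceOne_apply, trace_weightedTrace_one, hτ.2, one_smul]

theorem IsFlat.majorizes [DecidableEq C] [Nonempty A] [Nonempty C] [Nonempty O]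
    (hflat : IsFlat s N) (hN : IsChannel N) (hs : 0 < s) (hT : IsChannel T)
    (hle : choi T ≤ s • 1) : Majorizes N T := by
  obtain ⟨S, hS, hTS⟩ := hT.exists_complement hs hle
  refine ⟨_, isMixing_superMap (isConditionallyUnital_branch hN hs hflat hT hS hTS)
    (isIsometry_appendEntangled C A) (rank_rowMatrix_appendEntangled C A),
    LinearMap.ext fun X => ?_⟩
  change T X = branch (s⁻¹ • choi N) T S (reindexMap (Equiv.prodAssoc C A O)
    (ampliate (C × A) N (conjMap (appendEntangled C A) X)))
  rw [reindexMap_ampliate_appendEntangled, map_smul, branch_choi_kronecker hN hs.ne' hflat,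
    inv_smul_smul₀ (by simp)]

end FlatChannel

section FlatExamples

variable {A B : Type*} [DecidableEq A] [Fintype A]

theorem isFlat_conjMap [Fintype B] {V : Matrix B A ℂ} (hV : IsIsometry V) :
    IsFlat (Fintype.card A) (conjMap V) := by
  have hnorm : star (fun p : A × B => V p.2 p.1) ⬝ᵥ (fun p : A × B => V p.2 p.1) =
      (Fintype.card A : ℂ) := by
    rw [← Matrix.trace_one (n := A) (R := ℂ), ← hV]
    exact Fintype.sum_prod_type _
  rw [IsFlat, choi_conjMap, Matrix.vecMulVec_mul_vecMulVec, hnorm, Matrix.vecMulVec_smul]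

variable {s : ℂ} {Φ : MatMap A B}

theorem IsFlat.tensorUniform [Fintype B] (h : IsFlat s Φ) (S : Type*) [Fintype S]
    [DecidableEq S] : IsFlat (s / Fintype.card S) (tensorUniform S Φ) := by
  have huniform : uniformState S * uniformState S = (Fintype.card S : ℂ)⁻¹ • uniformState S := by
    rw [uniformState, smul_mul_assoc, one_mul]
  rw [IsFlat, choi_tensorUniform, Matrix.submatrix_mul_equiv, ← Matrix.mul_kronecker_mul, h,
    huniform, Matrix.smul_kronecker, Matrix.kronecker_smul, smul_smul, ← div_eq_mul_inv]
  rfl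

theorem IsFlat.conjMap_comp {O : Type*} [Fintype B] [DecidableEq B] [Fintype O] (h : IsFlat s Φ)
    {W : Matrix O B ℂ} (hW : IsIsometry W) : IsFlat s (conjMap W ∘ₗ Φ) := by
  set W' := (1 : Matrix A A ℂ) ⊗ₖ W
  have hW' : W'.conjTranspose * W' = 1 := by
    rw [Matrix.conjTranspose_kronecker, ← Matrix.mul_kronecker_mul, hW, Matrix.conjTranspose_one,
      one_mul, Matrix.one_kronecker_one]
  calc choi (conjMap W ∘ₗ Φ) * choi (conjMap W ∘ₗ Φ)
      = W' * (choi Φ * (W'.conjTranspose * W') * choi Φ) * W'.conjTranspose := by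
        simp only [choi_conjMap_comp, W', Matrix.mul_assoc]
    _ = s • choi (conjMap W ∘ₗ Φ) := by
        rw [hW', mul_one, h, Matrix.mul_smul, Matrix.smul_mul, choi_conjMap_comp]

theorem isFlat_stateChannel [Fintype B] {ψ : Matrix B B ℂ} (hψ : IsPureState ψ) :
    IsFlat 1 (stateChannel ψ) := by
  obtain ⟨v, hv, rfl⟩ := hψ
  rw [IsFlat, choi_stateChannel, one_smul]
  exact (Matrix.submatrix_mul_equiv _ _ _ (Equiv.punitProd B) _).trans <| by
    rw [Matrix.vecMulVec_mul_vecMulVec, hv, one_smul]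

end FlatExamples

section IsometryChannel

theorem natCast_div_le_natCast_div {a b c d : ℕ} (hb : 0 < b) (hd : 0 < d) (h : a * d ≤ c * b) :
    (a / b : ℂ) ≤ c / d := by
  have hreal : (a / b : ℝ) ≤ c / d :=
    (div_le_div_iff₀ (by exact_mod_cast hb) (by exact_mod_cast hd)).2 (by exact_mod_cast h)
  simpa only [Complex.ofReal_div, Complex.ofReal_natCast] using Complex.real_le_real.2 hreal

theorem natCast_card_div_card_pos (A B : Type*) [Fintype A] [Nonempty A] [Fintype B] [Nonempty B] :
    (0 : ℂ) < Fintype.card A / Fintype.card B :=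
  div_pos (by simp [Fintype.card_pos]) (by simp [Fintype.card_pos])

variable {A B B' C : Type*} [Fintype A] [DecidableEq A] [Fintype B] [Fintype B'] [DecidableEq B']
  [Fintype C] [DecidableEq C] {𝒱 : MatMap A B}

theorem IsIsometryChannel.isFlat (h𝒱 : IsIsometryChannel 𝒱) : IsFlat (Fintype.card A) 𝒱 := by
  obtain ⟨V, hV, rfl⟩ := h𝒱
  exact isFlat_conjMap hV

variable [DecidableEq B]

theorem IsPureState.majorizes_tensorUniform [Nonempty A] [Nonempty B] [Nonempty B']
    {ψ : Matrix (B × B') (B × B') ℂ} (hψ : IsPureState ψ) {Φ : MatMap A B} (hΦ : IsChannel Φ)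
    (h : Fintype.card A ≤ Fintype.card B') :
    Majorizes (stateChannel ψ) (tensorUniform B' Φ) := by
  refine (isFlat_stateChannel hψ).majorizes hψ.isState.isChannel_stateChannel one_pos
    (hΦ.tensorUniform B') ((choi_tensorUniform_le hΦ.choi_le B').trans ?_)
  refine smul_le_smul_of_nonneg_right ?_ zero_le_one
  simpa using natCast_div_le_natCast_div (c := 1) Fintype.card_pos one_pos (by simpa using h)

theorem IsIsometryChannel.tensorUniform_majorizes [Nonempty A] [Nonempty B] [Nonempty B']
    [Nonempty C] (h𝒱 : IsIsometryChannel 𝒱) {Φ : MatMap C (B × B')} (hΦ : IsChannel Φ)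
    (h : Fintype.card C * Fintype.card B' ≤ Fintype.card A) :
    Majorizes (tensorUniform B' 𝒱) Φ := by
  refine (h𝒱.isFlat.tensorUniform B').majorizes (h𝒱.isChannel.tensorUniform B')
    (natCast_card_div_card_pos A B') hΦ
    (hΦ.choi_le.trans (smul_le_smul_of_nonneg_right ?_ zero_le_one))
  simpa using natCast_div_le_natCast_div (b := 1) one_pos Fintype.card_pos (by simpa using h)

theorem IsIsometryChannel.majorizes [Nonempty A] [Nonempty B] [Nonempty C]
    (h𝒱 : IsIsometryChannel 𝒱) {Φ : MatMap C B} (hΦ : IsChannel Φ)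
    (h : Fintype.card C ≤ Fintype.card A) : Majorizes 𝒱 Φ := by
  refine h𝒱.isFlat.majorizes h𝒱.isChannel (by exact_mod_cast Fintype.card_pos) hΦ
    (hΦ.choi_le.trans (smul_le_smul_of_nonneg_right ?_ zero_le_one))
  exact_mod_cast h

theorem IsIsometryChannel.comp_tensorUniform_majorizes {D D' : Type*} [Fintype D] [DecidableEq D]
    [Fintype D'] [DecidableEq D'] [Nonempty A] [Nonempty B] [Nonempty B'] [Nonempty C] [Nonempty D]
    [Nonempty D'] (h𝒱 : IsIsometryChannel 𝒱) {𝒲 : MatMap (B × B') (D × D')}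
    (h𝒲 : IsIsometryChannel 𝒲) {Φ : MatMap C D} (hΦ : IsChannel Φ)
    (h : Fintype.card (C × D) ≤ Fintype.card (A × B)) :
    Majorizes (𝒲 ∘ₗ tensorUniform B' 𝒱) (tensorUniform D' Φ) := by
  have hchannel := h𝒲.isChannel.comp (h𝒱.isChannel.tensorUniform B')
  obtain ⟨W, hW, rfl⟩ := h𝒲
  have hcard : Fintype.card C * Fintype.card B' ≤ Fintype.card A * Fintype.card D' := by
    have hout := hW.card_le
    simp only [Fintype.card_prod] at h hout
    have hBD : 0 < Fintype.card B * Fintype.card D := mul_pos Fintype.card_pos Fintype.card_pos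
    refine Nat.le_of_mul_le_mul_right ?_ hBD
    linarith [Nat.mul_le_mul h hout]
  refine ((h𝒱.isFlat.tensorUniform B').conjMap_comp hW).majorizes hchannel
    (natCast_card_div_card_pos A B') (hΦ.tensorUniform D')
    ((choi_tensorUniform_le hΦ.choi_le D').trans (smul_le_smul_of_nonneg_right ?_ zero_le_one))
  exact natCast_div_le_natCast_div Fintype.card_pos Fintype.card_pos hcard

end IsometryChannel

end ChannelMajorization

theorem theorem13_general {A B B' C C' D D' : Type*}
    [Fintype A] [DecidableEq A] [Nonempty A] [Fintype B] [DecidableEq B] [Nonempty B]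
    [Fintype B'] [DecidableEq B'] [Nonempty B'] [Fintype C] [DecidableEq C] [Nonempty C]
    [Fintype C'] [DecidableEq C'] [Nonempty C'] [Fintype D] [DecidableEq D] [Nonempty D]
    [Fintype D'] [DecidableEq D'] [Nonempty D'] (𝒱 : MatMap A B) (h𝒱 : IsIsometryChannel 𝒱) :
    (Fintype.card B' ≤ Fintype.card A →
      ∀ ρ : Matrix (B × B') (B × B') ℂ, IsState ρ →
        Majorizes (tensorUniform B' 𝒱) (stateChannel ρ)) ∧
    (Fintype.card A ≤ Fintype.card B' →
      ∀ ψ : Matrix (B × B') (B × B') ℂ, IsPureState ψ →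
        Majorizes (stateChannel ψ) (tensorUniform B' 𝒱)) ∧
    (Fintype.card (C × D) ≤ Fintype.card (A × B) →
      ∀ ℳ : MatMap C D, IsChannel ℳ →
        ∀ 𝒲 : MatMap (B × B') (D × D'), IsIsometryChannel 𝒲 →
          Majorizes (𝒲 ∘ₗ tensorUniform B' 𝒱) (tensorUniform D' ℳ)) ∧
    (Fintype.card C' ≤ Fintype.card A →
      ∀ ℳ : MatMap C' B, IsChannel ℳ → Majorizes 𝒱 ℳ) :=
  ⟨fun h _ hρ => h𝒱.tensorUniform_majorizes hρ.isChannel_stateChannel (by simpa using h),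
    fun h _ hψ => hψ.majorizes_tensorUniform h𝒱.isChannel h,
    fun h _ hℳ _ h𝒲 => h𝒱.comp_tensorUniform_majorizes h𝒲 hℳ h,
    fun h _ hℳ => h𝒱.majorizes hℳ h⟩

theorem theorem13 {A B B' C D D' : Type*}
    [Fintype A] [DecidableEq A] [Nonempty A] [Fintype B] [DecidableEq B] [Nonempty B]
    [Fintype B'] [DecidableEq B'] [Nonempty B'] [Fintype C] [DecidableEq C] [Nonempty C]
    [Fintype D] [DecidableEq D] [Nonempty D] [Fintype D'] [DecidableEq D'] [Nonempty D']
    (𝒱 : MatMap A B) (h𝒱 : IsIsometryChannel 𝒱) :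
    -- the isometry channel together with a uniform replica of `A` is equivalent to a pure state
    (Fintype.card B' = Fintype.card A →
      ∀ ψ : Matrix (B × B') (B × B') ℂ, IsPureState ψ →
        Equivalent (tensorUniform B' 𝒱) (stateChannel ψ)) ∧
    -- majorization for all identifications `𝒲` of the output space `BB'` with `DD'`
    (Fintype.card (B × B') = Fintype.card (D × D') →
      Fintype.card (C × D) ≤ Fintype.card (A × B) →
      ∀ ℳ : MatMap C D, IsChannel ℳ →
        ∀ 𝒲 : MatMap (B × B') (D × D'), IsIsometryChannel 𝒲 →
          Majorizes (𝒲 ∘ₗ tensorUniform B' 𝒱) (tensorUniform D' ℳ)) ∧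
    -- isometry channels are maximal
    (∀ ℳ : MatMap A B, IsChannel ℳ → Majorizes 𝒱 ℳ) := by
  obtain ⟨toState, fromPure, composed, maximal⟩ :=
    theorem13_general (B' := B') (C := C) (C' := A) (D := D) (D' := D') 𝒱 h𝒱
  exact ⟨fun h ψ hψ => ⟨toState h.le ψ hψ.isState, fromPure h.ge ψ hψ⟩, fun _ => composed,
    maximal le_rfl⟩
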